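/- **Setting.** Consider the linear system $x_{t+1}=Ax_t+Bu_t+w_t$, $y_t=Cx_t+e_t$, $t\ge 1$, with a given initial state and arbitrary fixed disturbances $(w_t),(e_t)$, and losses $\ell_t(v)$ of $v=(y,u)\in\mathbb R^{d_y+d_u}$ that are $L$-subquadratic: $0\le \ell_t(v)\le L\max\{1,\|v\|^2\}$ and $|\ell_t(v)-\ell_t(v')|\le L\max\{1,\|v\|,\|v'\|\}\,\|v-v'\|$ (for differentiable $\ell_t$ the last condition follows from $\|\nabla\ell_t(v)\|\le L\max\{1,\|v\|\}$). A nominal dynamic controller $\pi_0$ is driven by exogenous inputs $u^{\rm ex}_t$ and returns features $\eta_t\in\mathbb R^{d_\eta}$: $$s_{t+1}=A_0s_t+B_0y_t+B_{0,u}u^{\rm ex}_t,\quad u_t=C_0s_t+D_0y_t+u^{\rm ex}_t,\quad \eta_t=C_{0,\eta}s_t+D_{0,\eta}y_t,\quad s_1=0.$$ Let $v_t^{\rm nat}=(y_t^{\rm nat},u_t^{\rm nat})$ and $\eta_t^{\rm nat}$ be the sequences obtained with $u^{\rm ex}\equiv0$, and let $G_{{\rm ex}\to v},G_{{\rm ex}\to\eta}$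 be the Markov operators (impulse responses) from $u^{\rm ex}$ to $v$ and to $\eta$. For a Markov operator $G=(G^{[i]})_{i\ge0}$ put $\|G\|_{\ell_1,\rm op}=\sum_{i\ge 0}\|G^{[i]}\|_{\rm op}$ and $\psi_G(n)=\sum_{i\ge n}\|G^{[i]}\|_{\rm op}$. Assume that $\|G_{{\rm ex}\to v}\|_{\ell_1,\rm op}$ and $\|G_{{\rm ex}\to\eta}\|_{\ell_1,\rm op}$ are at most $R_{\pi_0}<\infty$, that $\psi_{G_{{\rm ex}\to v}},\psi_{G_{{\rm ex}\to \eta}}\le\psi_{\pi_0}$ pointwise, where $\psi_{\pi_0}:\mathbb N\to[0,\infty)$ is non-increasing, and that $\|v_t^{\rm nat}\|,\|\eta_t^{\rm nat}\|\le R_{\rm nat}$ for all $t\ge1$. **Algorithm.** Let $\mathcal M=\{(M^{[0]},\dots,M^{[m-1]}):M^{[i]}\in\mathbb R^{d_u\times d_\eta},\ \sum_{i<m}\|M^{[i]}\|_{\rm op}\le R_{\mathcal M}\}$ and $u^{\rm ex}_t(M\mid\eta_{1:t})=\sum_{i=0}^{m-1}M^{[i]}\eta_{t-i}$, with $\eta_s:=0$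 for $s\le0$. In round $t$ the algorithm observes $y_t,\eta_t$, forms $\hat\eta_t=\eta_t-\sum_{i=1}^{t-1}G_{{\rm ex}\to\eta}^{[i]}u^{\rm ex}_{t-i}$ using the exact Markov operator, and plays $\pi_0$ with exogenous input $u^{\rm ex}_t=u^{\rm ex}_t(\mathbf M_t\mid\hat\eta_{1:t})$, where $\mathbf M_t\in\mathcal M$ are iterates of an arbitrary black-box procedure. This produces outputs $v_t^{\rm alg}$. **Benchmark.** A linear dynamic controller (LDC) $\pi$, given by $s_{t+1}=A_\pi s_t+B_\pi y_t$, $u_t=C_\pi s_t+D_\pi y_t$, $s_1=0$, with internal state of any dimension, produces outputs $v_t^\pi$ in closed loop. A conversion operator for $\pi$ is a Markov operator $G$ with $v_t^\pi=v_t^{\rm nat}+\sum_{i=1}^tG_{{\rm ex}\to v}^{[t-i]}\sum_{j=1}^iG^{[i-j]}\eta_j^{\rm nat}$ for all $t\ge1$. Let $\Pi_\star$ be the set of LDCs that have a conversion operator $G$ with $\|G\|_{\ell_1,\rm op}\le R_\star$ and $\psi_G\le\psi_\star$ pointwise, where $\psi_\star:\mathbb N\to[0,\infty)$ is non-increasing,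 and let $$\mathrm{ControlReg}_T=\sum_{t=1}^T\ell_t(v_t^{\rm alg})-\inf_{\pi\in\Pi_\star}\sum_{t=1}^T\ell_t(v_t^\pi).$$ **Memory regret.** Let $\mathfrak e(M)\in\mathbb R^{m d_u d_\eta}$ list the entries of $M$, let $\mathcal M_{\mathfrak e}=\mathfrak e(\mathcal M)$ and $\mathbf z_t=\mathfrak e(\mathbf M_t)$, and let $\mathbf Y_t$ be the matrix with $\mathbf Y_t\,\mathfrak e(M)=u^{\rm ex}_t(M\mid\eta^{\rm nat}_{1:t})$ for all $M$ ($\mathbf Y_s=0$ for $s\le0$). Put $F_t(z_{t:t-h})=\ell_t\big(v_t^{\rm nat}+\sum_{i=0}^hG_{{\rm ex}\to v}^{[i]}\mathbf Y_{t-i}z_{t-i}\big)$, $f_t(z)=F_t(z,\dots,z)$, and $$\mathrm{MemoryReg}_T=\sum_{t=1}^TF_t(\mathbf z_{t:t-h})-\inf_{z\in\mathcal M_{\mathfrak e}}\sum_{t=1}^Tf_t(z).$$ **Claim.** Let $T\ge1$, $m,h\ge0$ be integers, $R_{\rm nat}\ge1$, $R_{\mathcal M}\ge1$, $R_{\mathcal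 M}\ge R_\star$, and suppose that $\psi_\star(m)\le cR_\star/T$ and $\psi_{\pi_0}(h+1)\le cR_{\pi_0}/T$ for some $c>0$. Then $$\mathrm{ControlReg}_T\le\mathrm{MemoryReg}_T+12\,L\,c\,R_{\mathcal M}^2R_{\pi_0}^2R_{\rm nat}^2 .$$ The same holds for the static-feedback algorithm, in which $u_t=Ky_t+u^{\rm ex}_t$, the features are the measurements $\eta_t=y_t$, $G_{{\rm ex}\to v}$ is the Markov operator $G_K$ of the closed loop with $K$ (satisfying $\|G_K\|_{\ell_1,\rm op}\le R_{\pi_0}$ and $\psi_{G_K}\le\psi_{\pi_0}$), $G_{{\rm ex}\to\eta}$ consists of the $y$-rows of $G_K$, and $v^{\rm nat}_t=(y^K_t,Ky^K_t)$ satisfies $\|v^{\rm nat}_t\|\le R_{\rm nat}$. -/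

import Mathlib

open scoped Matrix.Norms.L2Operator ENNReal

noncomputable section

namespace DRC

/-! Rounds are indexed by `t = 0, 1, 2, …`; the horizon `T` consists of the rounds
`t ∈ Finset.range T`.  Signals are Euclidean vectors, and the norm `‖A‖` of a matrix is its
(Euclidean) operator norm. -/

/-- The space `ℝⁿ` with its Euclidean norm. -/
abbrev Vec (n : ℕ) : Type := EuclideanSpace ℝ (Fin n)

/-- The space of pairs `(y, u)`, with the Euclidean norm of the concatenated vector. -/
abbrev OutVec (dy du : ℕ) : Type := EuclideanSpace ℝ (Fin dy ⊕ Fin du)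

/-- Matrix-vector product on Euclidean vectors. -/
abbrev act {ι κ : Type*} [Fintype ι] [DecidableEq ι] [Fintype κ] [DecidableEq κ]
    (A : Matrix ι κ ℝ) (x : EuclideanSpace ℝ κ) : EuclideanSpace ℝ ι :=
  Matrix.toEuclideanLin A x

/-- The concatenation `(y, u)`. -/
def stack {dy du : ℕ} (y : Vec dy) (u : Vec du) : OutVec dy du :=
  WithLp.toLp 2 (Sum.elim (fun i => y i) (fun j => u j))

/-! ### Losses -/

/-- `L`-subquadratic losses: `0 ≤ ℓ(v) ≤ L max{1, ‖v‖²}`, and on every ball of radius `R ≥ 1`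
about the origin `ℓ` is `L R`-Lipschitz.  For differentiable `ℓ` the last condition follows
from `‖∇ ℓ(v)‖ ≤ L max{1, ‖v‖}`, see `isSubquadratic_of_gradient`. -/
structure IsSubquadratic {E : Type*} [NormedAddCommGroup E] (L : ℝ) (ℓ : E → ℝ) : Prop where
  nonneg : ∀ v, 0 ≤ ℓ v
  le : ∀ v, ℓ v ≤ L * max 1 (‖v‖ ^ 2)
  lipschitz : ∀ v v', |ℓ v - ℓ v'| ≤ L * max 1 (max ‖v‖ ‖v'‖) * ‖v - v'‖

theorem isSubquadratic_of_gradient {E : Type*} [NormedAddCommGroup E] [InnerProductSpace ℝ E]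
    [CompleteSpace E] {L : ℝ} {ℓ : E → ℝ} (h0 : ∀ v, 0 ≤ ℓ v)
    (h1 : ∀ v, ℓ v ≤ L * max 1 (‖v‖ ^ 2)) (hd : Differentiable ℝ ℓ)
    (hg : ∀ v, ‖gradient ℓ v‖ ≤ L * max 1 ‖v‖) : IsSubquadratic L ℓ := by
  have hL : 0 ≤ L := by
    have h := (h0 0).trans (h1 0)
    simpa using h
  refine ⟨h0, h1, fun v v' => ?_⟩
  have key := (convex_closedBall (0 : E) (max ‖v‖ ‖v'‖)).norm_image_sub_le_of_norm_fderiv_le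
    (𝕜 := ℝ) (f := ℓ) (C := L * max 1 (max ‖v‖ ‖v'‖)) (x := v') (y := v)
    (fun x _ => hd x) (fun x hx => ?_) (by simp) (by simp)
  · simpa [Real.norm_eq_abs] using key
  · have hx' : ‖x‖ ≤ max ‖v‖ ‖v'‖ := by simpa using hx
    have h2 : ‖fderiv ℝ ℓ x‖ = ‖gradient ℓ x‖ := by
      rw [gradient, LinearIsometryEquiv.norm_map]
    rw [h2]
    exact (hg x).trans (mul_le_mul_of_nonneg_left (max_le_max le_rfl hx') hL)

/-! ### Markov operators -/

/-- A Markov operator `G = (G^{[i]})_{i ≥ 0}`. -/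
abbrev Markov (ι κ : Type*) : Type _ := ℕ → Matrix ι κ ℝ

section Markov

variable {ι κ : Type*} [Fintype ι] [DecidableEq ι] [Fintype κ] [DecidableEq κ]

/-- The `ℓ₁,op` norm `∑_{i ≥ 0} ‖G^{[i]}‖`. -/
def l1op (G : Markov ι κ) : ℝ≥0∞ := ∑' i, ENNReal.ofReal ‖G i‖

/-- The decay function `ψ_G(n) = ∑_{i ≥ n} ‖G^{[i]}‖`. -/
def decay (G : Markov ι κ) (n : ℕ) : ℝ≥0∞ := ∑' i, ENNReal.ofReal ‖G (n + i)‖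

/-- The response `∑_{i ≤ t} G^{[t-i]} u_i` of a Markov operator to the inputs `u`. -/
def response (G : Markov ι κ) (u : ℕ → EuclideanSpace ℝ κ) (t : ℕ) : EuclideanSpace ℝ ι :=
  ∑ i ∈ Finset.range (t + 1), act (G (t - i)) (u i)

end Markov

/-- Proper, stable decay functions (real valued, so that `ψ 0 < ∞`). -/
structure IsDecayFunction (ψ : ℕ → ℝ) : Prop where
  nonneg : ∀ n, 0 ≤ ψ n
  antitone : Antitone ψ

/-! ### The plant and the linear dynamic controllers -/

/-- The system `x_{t+1} = A x_t + B u_t + w_t`, `y_t = C x_t + e_t`, with its initial state and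
its (fixed, arbitrary) disturbances `w`, `e`. -/
structure Plant (dx du dy : ℕ) where
  A : Matrix (Fin dx) (Fin dx) ℝ
  B : Matrix (Fin dx) (Fin du) ℝ
  C : Matrix (Fin dy) (Fin dx) ℝ
  x₀ : Vec dx
  w : ℕ → Vec dx
  e : ℕ → Vec dy

/-- A linear dynamic controller `s_{t+1} = A s_t + B y_t`, `u_t = C s_t + D y_t`. -/
structure LDC (dy du : ℕ) where
  dim : ℕ
  A : Matrix (Fin dim) (Fin dim) ℝ
  B : Matrix (Fin dim) (Fin dy) ℝ
  C : Matrix (Fin du) (Fin dim) ℝ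
  D : Matrix (Fin du) (Fin dy) ℝ

/-- A nominal controller `π₀` driven by exogenous inputs `uᵉˣ` and returning features `η`:
`s_{t+1} = A s_t + B y_t + Bᵤ uᵉˣ_t`, `u_t = C s_t + D y_t + uᵉˣ_t`, `η_t = C_η s_t + D_η y_t`. -/
structure NominalController (dy du dη : ℕ) where
  dim : ℕ
  A : Matrix (Fin dim) (Fin dim) ℝ
  B : Matrix (Fin dim) (Fin dy) ℝ
  Bu : Matrix (Fin dim) (Fin du) ℝ
  C : Matrix (Fin du) (Fin dim) ℝ
  D : Matrix (Fin du) (Fin dy) ℝ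
  Cη : Matrix (Fin dη) (Fin dim) ℝ
  Dη : Matrix (Fin dη) (Fin dy) ℝ

section Loops

variable {dx du dy dη : ℕ} (P : Plant dx du dy)

/-- The plant and controller states `(x_t, s_t)` when the LDC `π` is executed. -/
def ldcState (π : LDC dy du) : ℕ → Vec dx × Vec π.dim
  | 0 => (P.x₀, 0)
  | t + 1 =>
    let x := (ldcState π t).1
    let s := (ldcState π t).2
    let y := act P.C x + P.e t
    let u := act π.C s + act π.D y
    (act P.A x + act P.B u + P.w t, act π.A s + act π.B y)

/-- The sequence `(y^π_t, u^π_t)` produced by the LDC `π`. -/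
def ldcOut (π : LDC dy du) (t : ℕ) : OutVec dy du :=
  let x := (ldcState P π t).1
  let s := (ldcState P π t).2
  let y := act P.C x + P.e t
  stack y (act π.C s + act π.D y)

/-- The states `(x_t, s_t)` under the nominal controller with exogenous inputs `uex`. -/
def nomState (π₀ : NominalController dy du dη) (uex : ℕ → Vec du) :
    ℕ → Vec dx × Vec π₀.dim
  | 0 => (P.x₀, 0)
  | t + 1 =>
    let x := (nomState π₀ uex t).1
    let s := (nomState π₀ uex t).2
    let y := act P.C x + P.e t
    let u := act π₀.C s + act π₀.D y + uex t
    (act P.A x + act P.B u + P.w t, act π₀.A s + act π₀.B y + act π₀.Bu (uex t))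

/-- The outputs `(y_t, u_t)` under the nominal controller with exogenous inputs `uex`. -/
def nomOut (π₀ : NominalController dy du dη) (uex : ℕ → Vec du) (t : ℕ) : OutVec dy du :=
  let x := (nomState P π₀ uex t).1
  let s := (nomState P π₀ uex t).2
  let y := act P.C x + P.e t
  stack y (act π₀.C s + act π₀.D y + uex t)

/-- The features `η_t` under the nominal controller with exogenous inputs `uex`. -/
def nomFeature (π₀ : NominalController dy du dη) (uex : ℕ → Vec du) (t : ℕ) : Vec dη :=
  let x := (nomState P π₀ uex t).1
  let s := (nomState P π₀ uex t).2
  act π₀.Cη s + act π₀.Dη (act P.C x + P.e t)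

/-- Nature's outputs `vⁿᵃᵗ_t = (yⁿᵃᵗ_t, uⁿᵃᵗ_t)`: no exogenous input. -/
def natOut (π₀ : NominalController dy du dη) : ℕ → OutVec dy du := nomOut P π₀ 0

/-- Nature's features `ηⁿᵃᵗ_t`: no exogenous input. -/
def natFeature (π₀ : NominalController dy du dη) : ℕ → Vec dη := nomFeature P π₀ 0

/-- State matrix of the interconnection of the plant with `π₀`. -/
def clA (π₀ : NominalController dy du dη) :
    Matrix (Fin dx ⊕ Fin π₀.dim) (Fin dx ⊕ Fin π₀.dim) ℝ :=
  Matrix.fromBlocks (P.A + P.B * π₀.D * P.C) (P.B * π₀.C) (π₀.B * P.C) π₀.A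

/-- Input matrix of the interconnection of the plant with `π₀`. -/
def clB (π₀ : NominalController dy du dη) : Matrix (Fin dx ⊕ Fin π₀.dim) (Fin du) ℝ :=
  Matrix.fromRows P.B π₀.Bu

/-- The Markov operator `G_{ex→v}` from exogenous inputs to `v = (y, u)`. -/
def exToOut (π₀ : NominalController dy du dη) : Markov (Fin dy ⊕ Fin du) (Fin du)
  | 0 => Matrix.fromRows 0 1
  | i + 1 => Matrix.fromBlocks P.C 0 (π₀.D * P.C) π₀.C * clA P π₀ ^ i * clB P π₀

/-- The Markov operator `G_{ex→η}` from exogenous inputs to features. -/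
def exToFeature (π₀ : NominalController dy du dη) : Markov (Fin dη) (Fin du)
  | 0 => 0
  | i + 1 => Matrix.fromCols (π₀.Dη * P.C) π₀.Cη * clA P π₀ ^ i * clB P π₀

/-- The plant state `x_t` under static feedback `u_t = K y_t + uᵉˣ_t`. -/
def staticState (K : Matrix (Fin du) (Fin dy) ℝ) (uex : ℕ → Vec du) : ℕ → Vec dx
  | 0 => P.x₀
  | t + 1 =>
    let x := staticState K uex t
    let u := act K (act P.C x + P.e t) + uex t
    act P.A x + act P.B u + P.w t

/-- The measurement `y_t` under static feedback `u_t = K y_t + uᵉˣ_t`. -/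
def staticY (K : Matrix (Fin du) (Fin dy) ℝ) (uex : ℕ → Vec du) (t : ℕ) : Vec dy :=
  act P.C (staticState P K uex t) + P.e t

/-- The outputs `(y_t, u_t)` under static feedback `u_t = K y_t + uᵉˣ_t`. -/
def staticOut (K : Matrix (Fin du) (Fin dy) ℝ) (uex : ℕ → Vec du) (t : ℕ) : OutVec dy du :=
  stack (staticY P K uex t) (act K (staticY P K uex t) + uex t)

/-- The Markov operator `G_K` from exogenous inputs to `(y, u)` under static feedback `K`. -/
def staticMarkov (K : Matrix (Fin du) (Fin dy) ℝ) : Markov (Fin dy ⊕ Fin du) (Fin du)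
  | 0 => Matrix.fromRows 0 1
  | i + 1 => Matrix.fromRows P.C (K * P.C) * (P.A + P.B * K * P.C) ^ i * P.B

end Loops

/-! ### Disturbance response control -/

/-- Parameters `M = (M^{[0]}, …, M^{[m-1]})`. -/
abbrev Param (m du dη : ℕ) : Type := Fin m → Matrix (Fin du) (Fin dη) ℝ

/-- The set `{M : ∑_{i < m} ‖M^{[i]}‖ ≤ R}`. -/
def drcSet (m du dη : ℕ) (R : ℝ) : Set (Param m du dη) := {M | ∑ i, ‖M i‖ ≤ R}

/-- The input `uᵉˣ_t(M ∣ η) = ∑_{i < m} M^{[i]} η_{t-i}`, features before the first round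
being zero. -/
def drcInput {m du dη : ℕ} (M : Param m du dη) (η : ℕ → Vec dη) (t : ℕ) : Vec du :=
  ∑ i : Fin m, if (i : ℕ) ≤ t then act (M i) (η (t - i)) else 0

section Algorithm

variable {dx du dy dη m : ℕ} (P : Plant dx du dy)

/-- Feature recovery: the observed features minus the predicted effect `∑_{i=1}^{t} G^{[i]} u_{t-i}`
of the earlier exogenous inputs. -/
def recover (G : Markov (Fin dη) (Fin du)) (ηobs : ℕ → Vec dη) (uex : ℕ → Vec du) (t : ℕ) :
    Vec dη :=
  ηobs t - ∑ i ∈ Finset.Icc 1 t, act (G i) (uex (t - i))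

/-- The exogenous inputs played by the algorithm around the nominal controller `π₀`, with Markov
operator `Ghat` for the features and iterates `M t`.  In round `t` the features observed up to
now (which depend on the inputs of the earlier rounds only) are corrected to `ηhat`, and
`∑_{i < m} M_t^{[i]} ηhat_{t-i}` is played. -/
def algInput (π₀ : NominalController dy du dη) (Ghat : Markov (Fin dη) (Fin du))
    (M : ℕ → Param m du dη) (t : ℕ) : Vec du :=
  let past : ℕ → Vec du := fun j => if _h : j < t then algInput π₀ Ghat M j else 0
  let ηhat : ℕ → Vec dη := recover Ghat (nomFeature P π₀ past) past
  drcInput (M t) ηhat t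
termination_by t

/-- The outputs `(y_t, u_t)` of the algorithm around `π₀`. -/
def algOut (π₀ : NominalController dy du dη) (Ghat : Markov (Fin dη) (Fin du))
    (M : ℕ → Param m du dη) : ℕ → OutVec dy du :=
  nomOut P π₀ (algInput P π₀ Ghat M)

/-- The exogenous inputs played by the static-feedback algorithm: the features are the
measurements `y`, corrected by means of the `y`-rows of the Markov operator `Ghat`. -/
def staticAlgInput (K : Matrix (Fin du) (Fin dy) ℝ) (Ghat : Markov (Fin dy ⊕ Fin du) (Fin du))
    (M : ℕ → Param m du dy) (t : ℕ) : Vec du :=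
  let past : ℕ → Vec du := fun j => if _h : j < t then staticAlgInput K Ghat M j else 0
  let yhat : ℕ → Vec dy := recover (fun i => (Ghat i).toRows₁) (staticY P K past) past
  drcInput (M t) yhat t
termination_by t

/-- The outputs `(y_t, u_t)` of the static-feedback algorithm. -/
def staticAlgOut (K : Matrix (Fin du) (Fin dy) ℝ) (Ghat : Markov (Fin dy ⊕ Fin du) (Fin du))
    (M : ℕ → Param m du dy) : ℕ → OutVec dy du :=
  staticOut P K (staticAlgInput P K Ghat M)

end Algorithm

/-! ### Regret -/

section Regret

variable {dx du dy dη m : ℕ}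

/-- `G` converts the nominal controller into `π`: fed with the inputs `∑_{i ≤ t} G^{[t-i]} η_i`,
where `η` are nature's features, the nominal closed loop (nature's outputs `vnat`, Markov
operator `Gv`) reproduces the outputs of `π`. -/
def IsConversion (P : Plant dx du dy) (vnat : ℕ → OutVec dy du)
    (Gv : Markov (Fin dy ⊕ Fin du) (Fin du)) (η : ℕ → Vec dη) (π : LDC dy du)
    (G : Markov (Fin du) (Fin dη)) : Prop :=
  ∀ t, ldcOut P π t = vnat t + response Gv (response G η) t

/-- The comparator class `Π_stab(R, ψ)`: the LDCs with a conversion operator of `ℓ₁,op` norm at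
most `R` and decay function at most `ψ`. -/
def stabClass (P : Plant dx du dy) (vnat : ℕ → OutVec dy du)
    (Gv : Markov (Fin dy ⊕ Fin du) (Fin du)) (η : ℕ → Vec dη) (R : ℝ) (ψ : ℕ → ℝ) :
    Set (LDC dy du) :=
  {π | ∃ G : Markov (Fin du) (Fin dη), IsConversion P vnat Gv η π G ∧
    l1op G ≤ ENNReal.ofReal R ∧ ∀ n, decay G n ≤ ENNReal.ofReal (ψ n)}

/-- `ControlReg_T`: the cumulative loss of the outputs `v` minus that of the best LDC in `Pi`. -/
def controlReg (P : Plant dx du dy) (ℓ : ℕ → OutVec dy du → ℝ) (T : ℕ)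
    (v : ℕ → OutVec dy du) (Pi : Set (LDC dy du)) : ℝ :=
  ∑ t ∈ Finset.range T, ℓ t (v t) -
    sInf ((fun π => ∑ t ∈ Finset.range T, ℓ t (ldcOut P π t)) '' Pi)

/-- The parameter space of vectors `z`, of dimension `m · du · dη`. -/
abbrev ZSpace (m du dη : ℕ) : Type := EuclideanSpace ℝ (Fin m × Fin du × Fin dη)

/-- The embedding `M ↦ z` that lists the entries of `M`. -/
def embed (M : Param m du dη) : ZSpace m du dη :=
  WithLp.toLp 2 (fun p => M p.1 p.2.1 p.2.2)

/-- The matrix `Y_t` with `Y_t (embed M) = uᵉˣ_t(M ∣ η)`. -/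
def featureMatrix (m du : ℕ) (η : ℕ → Vec dη) (t : ℕ) :
    Matrix (Fin du) (Fin m × Fin du × Fin dη) ℝ :=
  fun a p => if a = p.2.1 ∧ (p.1 : ℕ) ≤ t then η (t - p.1) p.2.2 else 0

/-- The loss with memory `F_t(z_{t:t-h} ∣ η) = ℓ_t(vnat_t + ∑_{i ≤ h} G^{[i]} Y_{t-i} z_{t-i})`,
with `Y_s = 0` before the first round.  Of the sequence `z` only `z_t, …, z_{t-h}` enter. -/
def memLoss (ℓ : ℕ → OutVec dy du → ℝ) (vnat : ℕ → OutVec dy du)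
    (Gv : Markov (Fin dy ⊕ Fin du) (Fin du)) (η : ℕ → Vec dη) (h t : ℕ)
    (z : ℕ → ZSpace m du dη) : ℝ :=
  ℓ t (vnat t + ∑ i ∈ Finset.range (h + 1),
    if i ≤ t then act (Gv i) (act (featureMatrix m du η (t - i)) (z (t - i))) else 0)

/-- The unary specialization `f_t(z ∣ η) = F_t(z, …, z ∣ η)`. -/
def unaryLoss (ℓ : ℕ → OutVec dy du → ℝ) (vnat : ℕ → OutVec dy du)
    (Gv : Markov (Fin dy ⊕ Fin du) (Fin du)) (η : ℕ → Vec dη) (h t : ℕ)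
    (z : ZSpace m du dη) : ℝ :=
  memLoss ℓ vnat Gv η h t (fun _ => z)

/-- `MemoryReg_T` of the iterates `z_t = embed (M t)`, against the best fixed `z` in the embedded
parameter set of radius `R`. -/
def memoryReg (ℓ : ℕ → OutVec dy du → ℝ) (vnat : ℕ → OutVec dy du)
    (Gv : Markov (Fin dy ⊕ Fin du) (Fin du)) (η : ℕ → Vec dη) (h T : ℕ) (R : ℝ)
    (M : ℕ → Param m du dη) : ℝ :=
  ∑ t ∈ Finset.range T, memLoss ℓ vnat Gv η h t (fun s => embed (M s)) -
    sInf ((fun z => ∑ t ∈ Finset.range T, unaryLoss ℓ vnat Gv η h t z) ''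
      (embed '' drcSet m du dη R))

end Regret

end DRC

end

open DRC

/-! By superposition, a closed loop driven by exogenous inputs is nature's trajectory plus the
response of a Markov operator (`nomOut_eq`, `nomFeature_eq`, `staticOut_eq`, `staticY_eq`).
Subtracting the predicted response with the exact operator therefore recovers nature's features
whatever was played (`algInput_eq`, `staticAlgInput_eq`). The algorithm's output is thus nature's
output plus the response of `Gv` to inputs built from nature's features.

Two comparisons remain. The algorithm's loss differs from the memory loss only in cutting `Gv` after
`h + 1` terms. A benchmark controller is the response to its full conversion operator `G`; the first
`m` terms of `G` form a feasible parameter, and replacing `G` by them and then cutting `Gv` costs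
two small tails. All these outputs have norm at most `2 R₀ RM Rnat`, where the losses are Lipschitz,
so `loss_sub_le` bounds each comparison by `4 L c RM² R₀² Rnat² / T` per round. The total over `T`
rounds has constant 8, within the claimed 12. -/

namespace DRC

open Finset

/-! ### Matrix action on Euclidean vectors and on stacked vectors. -/

section Matrices

variable {ι κ τ : Type*} [Fintype ι] [DecidableEq ι] [Fintype κ] [DecidableEq κ]
  [Fintype τ] [DecidableEq τ]

theorem act_apply (A : Matrix ι κ ℝ) (x : EuclideanSpace ℝ κ) (i : ι) :
    act A x i = ∑ j, A i j * x j := rfl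

theorem act_mul (A : Matrix ι κ ℝ) (B : Matrix κ τ ℝ) (x : EuclideanSpace ℝ τ) :
    act (A * B) x = act A (act B x) := by
  ext i
  exact congrFun (Matrix.mulVec_mulVec (WithLp.ofLp x) A B).symm i

theorem act_one (x : EuclideanSpace ℝ ι) : act (1 : Matrix ι ι ℝ) x = x := by
  ext i
  exact congrFun (Matrix.one_mulVec (WithLp.ofLp x)) i

theorem act_zero_matrix (x : EuclideanSpace ℝ κ) : act (0 : Matrix ι κ ℝ) x = 0 := by
  simp [act]

theorem act_add_matrix (A B : Matrix ι κ ℝ) (x : EuclideanSpace ℝ κ) :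
    act (A + B) x = act A x + act B x := by
  simp [act]

theorem act_add (A : Matrix ι κ ℝ) (x y : EuclideanSpace ℝ κ) :
    act A (x + y) = act A x + act A y :=
  map_add _ x y

theorem act_sub (A : Matrix ι κ ℝ) (x y : EuclideanSpace ℝ κ) :
    act A (x - y) = act A x - act A y :=
  map_sub _ x y

theorem act_zero (A : Matrix ι κ ℝ) : act A (0 : EuclideanSpace ℝ κ) = 0 :=
  map_zero _

theorem act_sum {σ : Type*} (A : Matrix ι κ ℝ) (S : Finset σ) (x : σ → EuclideanSpace ℝ κ) :
    act A (∑ i ∈ S, x i) = ∑ i ∈ S, act A (x i) :=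
  map_sum _ x S

theorem norm_act_le (A : Matrix ι κ ℝ) (x : EuclideanSpace ℝ κ) : ‖act A x‖ ≤ ‖A‖ * ‖x‖ :=
  Matrix.l2_opNorm_mulVec A x

end Matrices

section Stack

variable {a b c d k : ℕ}

theorem stack_add (y y' : Vec a) (u u' : Vec b) :
    stack (y + y') (u + u') = stack y u + stack y' u' := by
  ext (i | i) <;> rfl

theorem norm_fst_le_norm_stack (y : Vec a) (u : Vec b) : ‖y‖ ≤ ‖stack y u‖ := by
  rw [EuclideanSpace.norm_eq, EuclideanSpace.norm_eq]
  refine Real.sqrt_le_sqrt ?_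
  rw [Fintype.sum_sum_type]
  exact le_add_of_nonneg_right (sum_nonneg fun i _ => sq_nonneg _)

theorem norm_snd_le_norm_stack (y : Vec a) (u : Vec b) : ‖u‖ ≤ ‖stack y u‖ := by
  rw [EuclideanSpace.norm_eq, EuclideanSpace.norm_eq]
  refine Real.sqrt_le_sqrt ?_
  rw [Fintype.sum_sum_type]
  exact le_add_of_nonneg_left (sum_nonneg fun i _ => sq_nonneg _)

theorem act_fromBlocks_stack (A : Matrix (Fin a) (Fin c) ℝ) (B : Matrix (Fin a) (Fin d) ℝ)
    (C : Matrix (Fin b) (Fin c) ℝ) (D : Matrix (Fin b) (Fin d) ℝ) (x : Vec c) (s : Vec d) :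
    act (Matrix.fromBlocks A B C D) (stack x s) =
      stack (act A x + act B s) (act C x + act D s) := by
  ext (i | i) <;> simp only [act_apply, Fintype.sum_sum_type] <;> rfl

theorem act_fromCols_stack (A : Matrix (Fin a) (Fin c) ℝ) (B : Matrix (Fin a) (Fin d) ℝ)
    (x : Vec c) (s : Vec d) :
    act (Matrix.fromCols A B) (stack x s) = act A x + act B s := by
  ext i
  simp only [act_apply, Fintype.sum_sum_type, PiLp.add_apply]
  rfl

theorem act_fromRows (A : Matrix (Fin a) (Fin c) ℝ) (B : Matrix (Fin b) (Fin c) ℝ) (x : Vec c) :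
    act (Matrix.fromRows A B) x = stack (act A x) (act B x) := by
  ext (i | i) <;> rfl

end Stack

/-! ### State-space realizations and superposition in the closed loops. -/

section LinearSystem

variable {ι κ τ : Type*} [Fintype ι] [DecidableEq ι] [Fintype κ] [DecidableEq κ]
  [Fintype τ] [DecidableEq τ]

/-- State-space formula: the output of `X_{t+1} = A X_t + B u_t`, `X_0 = 0`, is the response of
the Markov operator `D, C B, C A B, C A² B, …`. -/
theorem response_eq_of_state {G : Markov ι κ} {A : Matrix τ τ ℝ} {B : Matrix τ κ ℝ}
    {C : Matrix ι τ ℝ} (hG : ∀ i, G (i + 1) = C * A ^ i * B)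
    {X : ℕ → EuclideanSpace ℝ τ} {u : ℕ → EuclideanSpace ℝ κ} (h0 : X 0 = 0)
    (hX : ∀ t, X (t + 1) = act A (X t) + act B (u t)) (t : ℕ) :
    response G u t = act C (X t) + act (G 0) (u t) := by
  -- Variation of constants; the truncated subtraction is harmless because `i < t`.
  have key : ∀ t, X t = ∑ i ∈ range t, act (A ^ (t - 1 - i)) (act B (u i)) := by
    intro t
    induction t with
    | zero => simpa using h0
    | succ t ih =>
      rw [hX, ih, sum_range_succ, act_sum]
      congr 1
      · refine sum_congr rfl fun i hi => ?_
        have hi' := mem_range.1 hi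
        rw [← act_mul, ← pow_succ']
        congr 3
        omega
      · simp [act_one]
  rw [response, sum_range_succ, key t, act_sum, Nat.sub_self]
  congr 1
  refine sum_congr rfl fun i hi => ?_
  have hi' := mem_range.1 hi
  obtain ⟨j, rfl⟩ : ∃ j, t = i + 1 + j := ⟨t - (i + 1), by omega⟩
  rw [show i + 1 + j - i = j + 1 by omega, show i + 1 + j - 1 - i = j by omega, hG, act_mul,
    act_mul]

end LinearSystem

section Loops

variable {dx du dy dη : ℕ} (P : Plant dx du dy)

/-- Deviation of the closed-loop state from nature's state. -/
noncomputable def nomDev (π₀ : NominalController dy du dη) (uex : ℕ → Vec du) (t : ℕ) :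
    OutVec dx π₀.dim :=
  stack ((nomState P π₀ uex t).1 - (nomState P π₀ 0 t).1)
    ((nomState P π₀ uex t).2 - (nomState P π₀ 0 t).2)

theorem nomDev_zero (π₀ : NominalController dy du dη) (uex : ℕ → Vec du) :
    nomDev P π₀ uex 0 = 0 := by
  simp only [nomDev, nomState, sub_self]
  ext (i | i) <;> rfl

/-- The disturbances are the same in both runs and cancel, leaving a homogeneous linear recursion
driven by `uex` alone. -/
theorem nomDev_succ (π₀ : NominalController dy du dη) (uex : ℕ → Vec du) (t : ℕ) :
    nomDev P π₀ uex (t + 1) = act (clA P π₀) (nomDev P π₀ uex t) + act (clB P π₀) (uex t) := by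
  simp only [nomDev, nomState, clA, clB, act_fromBlocks_stack, act_fromRows, ← stack_add,
    act_add_matrix, act_mul, act_sub, act_add, Pi.zero_apply, act_zero]
  congr 1 <;> abel

theorem nomOut_eq (π₀ : NominalController dy du dη) (uex : ℕ → Vec du) (t : ℕ) :
    nomOut P π₀ uex t = natOut P π₀ t + response (exToOut P π₀) uex t := by
  rw [response_eq_of_state (fun _ => rfl) (nomDev_zero P π₀ uex) (nomDev_succ P π₀ uex)]
  simp only [natOut, nomOut, nomDev, exToOut, act_fromBlocks_stack, act_fromRows, ← stack_add,
    act_mul, act_one, act_zero_matrix, act_sub, act_add, Pi.zero_apply]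
  congr 1 <;> abel

theorem nomFeature_eq (π₀ : NominalController dy du dη) (uex : ℕ → Vec du) (t : ℕ) :
    nomFeature P π₀ uex t = natFeature P π₀ t + response (exToFeature P π₀) uex t := by
  rw [response_eq_of_state (fun _ => rfl) (nomDev_zero P π₀ uex) (nomDev_succ P π₀ uex)]
  simp only [natFeature, nomFeature, nomDev, exToFeature, act_fromCols_stack,
    act_mul, act_zero_matrix, act_sub, act_add]
  abel

/-- The nominal controller without exogenous inputs, as an LDC. -/
def NominalController.toLDC (π₀ : NominalController dy du dη) : LDC dy du where
  dim := π₀.dim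
  A := π₀.A
  B := π₀.B
  C := π₀.C
  D := π₀.D

theorem ldcState_toLDC (π₀ : NominalController dy du dη) (t : ℕ) :
    ldcState P π₀.toLDC t = nomState P π₀ 0 t := by
  induction t with
  | zero => rfl
  | succ t ih =>
    simp only [ldcState, nomState, ih, Pi.zero_apply, act_zero, add_zero]
    rfl

/-- Used, like `ldcOut_staticLDC` for static feedback, to show that the comparator class is
nonempty. -/
theorem ldcOut_toLDC (π₀ : NominalController dy du dη) (t : ℕ) :
    ldcOut P π₀.toLDC t = natOut P π₀ t := by
  simp only [ldcOut, natOut, nomOut, ldcState_toLDC, Pi.zero_apply, add_zero]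
  rfl

/-- The static feedback law `K`, as an LDC without internal state. -/
noncomputable def staticLDC (K : Matrix (Fin du) (Fin dy) ℝ) : LDC dy du where
  dim := 0
  A := 0
  B := 0
  C := 0
  D := K

theorem act_staticLDC_C (K : Matrix (Fin du) (Fin dy) ℝ) (s : Vec (staticLDC K).dim) :
    act (staticLDC K).C s = 0 :=
  act_zero_matrix s

theorem ldcState_staticLDC_fst (K : Matrix (Fin du) (Fin dy) ℝ) (t : ℕ) :
    (ldcState P (staticLDC K) t).1 = staticState P K 0 t := by
  induction t with
  | zero => rfl
  | succ t ih =>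
    simp only [ldcState, staticState, ih, Pi.zero_apply, add_zero, act_staticLDC_C, zero_add]
    rfl

theorem ldcOut_staticLDC (K : Matrix (Fin du) (Fin dy) ℝ) (t : ℕ) :
    ldcOut P (staticLDC K) t = staticOut P K 0 t := by
  simp only [ldcOut, staticOut, staticY, ldcState_staticLDC_fst, Pi.zero_apply, add_zero,
    act_staticLDC_C, zero_add]
  rfl

theorem staticDev_succ (K : Matrix (Fin du) (Fin dy) ℝ) (uex : ℕ → Vec du) (t : ℕ) :
    staticState P K uex (t + 1) - staticState P K 0 (t + 1) =
      act (P.A + P.B * K * P.C) (staticState P K uex t - staticState P K 0 t) +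
        act P.B (uex t) := by
  simp only [staticState, act_add_matrix, act_mul, act_sub, act_add, Pi.zero_apply, act_zero]
  abel

theorem staticOut_eq (K : Matrix (Fin du) (Fin dy) ℝ) (uex : ℕ → Vec du) (t : ℕ) :
    staticOut P K uex t = staticOut P K 0 t + response (staticMarkov P K) uex t := by
  rw [response_eq_of_state (fun _ => rfl)
    (X := fun t => staticState P K uex t - staticState P K 0 t)
    (sub_self _) (staticDev_succ P K uex)]
  rw [staticMarkov, act_fromRows, act_fromRows]
  simp only [staticOut, staticY, ← stack_add,
    act_mul, act_one, act_zero_matrix, act_sub, act_add, Pi.zero_apply]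
  congr 1 <;> abel

theorem staticY_eq (K : Matrix (Fin du) (Fin dy) ℝ) (uex : ℕ → Vec du) (t : ℕ) :
    staticY P K uex t =
      staticY P K 0 t + response (fun i => (staticMarkov P K i).toRows₁) uex t := by
  rw [response_eq_of_state (A := P.A + P.B * K * P.C) (B := P.B) (C := P.C) (fun i => ?_)
    (X := fun t => staticState P K uex t - staticState P K 0 t)
    (sub_self _) (staticDev_succ P K uex)]
  · simp only [staticY, staticMarkov, Matrix.toRows₁_fromRows, act_zero_matrix, act_sub]
    abel
  · simp only [staticMarkov, Matrix.fromRows_mul, Matrix.toRows₁_fromRows]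

end Loops

/-! ### Truncated responses and their tail bounds. -/

section Truncation

variable {ι κ : Type*} [Fintype ι] [DecidableEq ι] [Fintype κ] [DecidableEq κ]

/-- The response `∑_{i < n} G^{[i]} u_{t-i}` of the first `n` terms of a Markov operator. -/
noncomputable def truncResponse (G : Markov ι κ) (n : ℕ) (u : ℕ → EuclideanSpace ℝ κ) (t : ℕ) :
    EuclideanSpace ℝ ι :=
  ∑ i ∈ range n, if i ≤ t then act (G i) (u (t - i)) else 0

theorem response_eq_sum (G : Markov ι κ) (u : ℕ → EuclideanSpace ℝ κ) (t : ℕ) :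
    response G u t = ∑ i ∈ range (t + 1), act (G i) (u (t - i)) := by
  rw [response, ← sum_range_reflect]
  refine sum_congr rfl fun i hi => ?_
  have hi' := mem_range.1 hi
  rw [show t + 1 - 1 - i = t - i by omega, show t - (t - i) = i by omega]

/-- Puts the head over the index set of the full response, so that the tail is the complementary
sub-sum. -/
theorem truncResponse_eq_sum_filter (G : Markov ι κ) (n : ℕ) (u : ℕ → EuclideanSpace ℝ κ)
    (t : ℕ) : truncResponse G n u t =
      ∑ i ∈ (range (t + 1)).filter (· < n), act (G i) (u (t - i)) := by
  rw [truncResponse, ← sum_filter]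
  refine sum_congr ?_ fun _ _ => rfl
  ext i
  simp only [mem_filter, mem_range]
  omega

theorem response_sub_truncResponse (G : Markov ι κ) (n : ℕ) (u : ℕ → EuclideanSpace ℝ κ)
    (t : ℕ) : response G u t - truncResponse G n u t =
      ∑ i ∈ (range (t + 1)).filter (¬ · < n), act (G i) (u (t - i)) := by
  rw [response_eq_sum, truncResponse_eq_sum_filter, sub_eq_iff_eq_add']
  exact (sum_filter_add_sum_filter_not _ _ _).symm

theorem truncResponse_sub (G : Markov ι κ) (n : ℕ) (u v : ℕ → EuclideanSpace ℝ κ) (t : ℕ) :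
    truncResponse G n (fun s => u s - v s) t = truncResponse G n u t - truncResponse G n v t := by
  simp only [truncResponse_eq_sum_filter, act_sub, sum_sub_distrib]

theorem norm_sum_act_le (G : Markov ι κ) {u : ℕ → EuclideanSpace ℝ κ} {t : ℕ} {b : ℝ}
    (hu : ∀ s ≤ t, ‖u s‖ ≤ b) (S : Finset ℕ) :
    ‖∑ i ∈ S, act (G i) (u (t - i))‖ ≤ (∑ i ∈ S, ‖G i‖) * b := by
  rw [sum_mul]
  exact norm_sum_le_of_le _ fun i _ => (norm_act_le _ _).trans
    (mul_le_mul_of_nonneg_left (hu _ (Nat.sub_le _ _)) (norm_nonneg _))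

omit [DecidableEq ι] in
-- Shifting by `n` is injective on `S` and makes the finite sum a partial sum of the series. The
-- assumption `0 ≤ r` is needed because `ENNReal.ofReal` sends negative numbers to zero.
theorem sum_norm_le_of_decay {G : Markov ι κ} {n : ℕ} {r : ℝ} (hr : 0 ≤ r)
    (h : decay G n ≤ ENNReal.ofReal r) {S : Finset ℕ} (hS : ∀ i ∈ S, n ≤ i) :
    ∑ i ∈ S, ‖G i‖ ≤ r := by
  have h1 : ∑ i ∈ S, ENNReal.ofReal ‖G i‖ ≤ decay G n := by
    have hinj : Set.InjOn (fun i => i - n) S := fun i hi j hj hij => by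
      have := hS i hi
      have := hS j hj
      simp only at hij
      omega
    calc ∑ i ∈ S, ENNReal.ofReal ‖G i‖
        = ∑ j ∈ S.image (fun i => i - n), ENNReal.ofReal ‖G (n + j)‖ := by
          rw [sum_image hinj]
          refine sum_congr rfl fun i hi => ?_
          rw [Nat.add_sub_cancel' (hS i hi)]
      _ ≤ decay G n := ENNReal.sum_le_tsum _
  rw [← ENNReal.ofReal_sum_of_nonneg fun _ _ => norm_nonneg _] at h1
  exact (ENNReal.ofReal_le_ofReal_iff hr).1 (h1.trans h)

omit [DecidableEq ι] in
theorem sum_norm_le_of_l1op {G : Markov ι κ} {r : ℝ} (hr : 0 ≤ r)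
    (h : l1op G ≤ ENNReal.ofReal r) (S : Finset ℕ) : ∑ i ∈ S, ‖G i‖ ≤ r :=
  sum_norm_le_of_decay (n := 0) hr (by simpa only [decay, Nat.zero_add, l1op] using h)
    fun _ _ => Nat.zero_le _

variable {G : Markov ι κ} {u : ℕ → EuclideanSpace ℝ κ} {t : ℕ} {b r : ℝ}

theorem norm_response_le (hr : 0 ≤ r) (hG : l1op G ≤ ENNReal.ofReal r)
    (hu : ∀ s ≤ t, ‖u s‖ ≤ b) : ‖response G u t‖ ≤ r * b := by
  have hb : 0 ≤ b := (norm_nonneg _).trans (hu t le_rfl)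
  rw [response_eq_sum]
  exact (norm_sum_act_le G hu _).trans
    (mul_le_mul_of_nonneg_right (sum_norm_le_of_l1op hr hG _) hb)

theorem norm_truncResponse_le (hr : 0 ≤ r) (hG : l1op G ≤ ENNReal.ofReal r)
    (hu : ∀ s ≤ t, ‖u s‖ ≤ b) (n : ℕ) : ‖truncResponse G n u t‖ ≤ r * b := by
  have hb : 0 ≤ b := (norm_nonneg _).trans (hu t le_rfl)
  rw [truncResponse_eq_sum_filter]
  exact (norm_sum_act_le G hu _).trans
    (mul_le_mul_of_nonneg_right (sum_norm_le_of_l1op hr hG _) hb)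

theorem norm_response_sub_truncResponse_le {n : ℕ} (hr : 0 ≤ r)
    (hG : decay G n ≤ ENNReal.ofReal r) (hu : ∀ s ≤ t, ‖u s‖ ≤ b) :
    ‖response G u t - truncResponse G n u t‖ ≤ r * b := by
  have hb : 0 ≤ b := (norm_nonneg _).trans (hu t le_rfl)
  rw [response_sub_truncResponse]
  refine (norm_sum_act_le G hu _).trans
    (mul_le_mul_of_nonneg_right (sum_norm_le_of_decay hr hG fun i hi => ?_) hb)
  simpa using (mem_filter.1 hi).2

end Truncation

/-! ### Controller parameters and the memory loss. -/

section Parameters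

variable {dx du dy dη m : ℕ}

theorem act_featureMatrix_embed (M : Param m du dη) (η : ℕ → Vec dη) (t : ℕ) :
    act (featureMatrix m du η t) (embed M) = drcInput M η t := by
  ext a
  rw [act_apply, drcInput, WithLp.ofLp_sum, Finset.sum_apply, Fintype.sum_prod_type]
  refine sum_congr rfl fun i _ => ?_
  rw [Fintype.sum_prod_type, sum_eq_single a]
  · by_cases hi : (i : ℕ) ≤ t
    · simp [featureMatrix, embed, hi, act_apply, mul_comm]
    · simp [featureMatrix, hi]
  · intro b _ hb
    simp [featureMatrix, hb.symm]
  · simp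

/-- This turns a conversion operator, cut after `m` terms, into a competitor for the memory regret.
-/
theorem drcInput_eq_truncResponse (G : Markov (Fin du) (Fin dη)) (η : ℕ → Vec dη) (t : ℕ) :
    drcInput (fun i : Fin m => G i) η t = truncResponse G m η t :=
  Fin.sum_univ_eq_sum_range (fun i => if i ≤ t then act (G i) (η (t - i)) else 0) m

theorem norm_drcInput_le {M : Param m du dη} {R b : ℝ} (hM : M ∈ drcSet m du dη R)
    {η : ℕ → Vec dη} (hη : ∀ t, ‖η t‖ ≤ b) (t : ℕ) : ‖drcInput M η t‖ ≤ R * b := by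
  have hb : 0 ≤ b := (norm_nonneg _).trans (hη 0)
  refine le_trans ?_ (mul_le_mul_of_nonneg_right hM hb)
  rw [sum_mul]
  refine norm_sum_le_of_le _ fun i _ => ?_
  split_ifs
  · exact (norm_act_le _ _).trans (mul_le_mul_of_nonneg_left (hη _) (norm_nonneg _))
  · simpa using mul_nonneg (norm_nonneg _) hb

theorem memLoss_eq (ℓ : ℕ → OutVec dy du → ℝ) (vnat : ℕ → OutVec dy du)
    (Gv : Markov (Fin dy ⊕ Fin du) (Fin du)) (η : ℕ → Vec dη) (h t : ℕ) (M : ℕ → Param m du dη) :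
    memLoss ℓ vnat Gv η h t (fun s => embed (M s)) =
      ℓ t (vnat t + truncResponse Gv (h + 1) (fun s => drcInput (M s) η s) t) := by
  simp only [memLoss, truncResponse, act_featureMatrix_embed]

end Parameters

/-! ### Exact recovery of nature's features. -/

section Recovery

variable {dx du dy dη m : ℕ} (P : Plant dx du dy)

/-- The correction starts at lag 1, so it removes the whole response precisely because the lag-0
term vanishes. -/
theorem recover_eq {G : Markov (Fin dη) (Fin du)} (hG : G 0 = 0) {η ηnat : ℕ → Vec dη}
    {uex : ℕ → Vec du} (h : ∀ t, η t = ηnat t + response G uex t) : recover G η uex = ηnat := by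
  funext t
  rw [recover, h, response_eq_sum, range_eq_Ico, sum_eq_sum_Ico_succ_bot (Nat.succ_pos t), hG,
    act_zero_matrix, zero_add]
  exact add_sub_cancel_right _ _

theorem algInput_eq (π₀ : NominalController dy du dη) (M : ℕ → Param m du dη) (t : ℕ) :
    algInput P π₀ (exToFeature P π₀) M t = drcInput (M t) (natFeature P π₀) t := by
  rw [algInput]
  -- Recovery is exact for any input sequence, including the past inputs padded by zeros, so no
  -- induction on `t` is needed.
  rw [recover_eq rfl (nomFeature_eq P π₀ _)]

theorem staticAlgInput_eq (K : Matrix (Fin du) (Fin dy) ℝ) (M : ℕ → Param m du dy) (t : ℕ) :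
    staticAlgInput P K (staticMarkov P K) M t = drcInput (M t) (staticY P K 0) t := by
  rw [staticAlgInput]
  rw [recover_eq (by simp [staticMarkov]) (staticY_eq P K _)]

end Recovery

end DRC

namespace DRC

open Finset

/-! ### Loss comparison and the regret bound. -/

section Comparison

theorem IsSubquadratic.const_nonneg {E : Type*} [NormedAddCommGroup E] {L : ℝ} {ℓ : E → ℝ}
    (h : IsSubquadratic L ℓ) : 0 ≤ L := by
  simpa using (h.nonneg 0).trans (h.le 0)

theorem IsSubquadratic.sub_le {E : Type*} [NormedAddCommGroup E] {L : ℝ} {ℓ : E → ℝ}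
    (h : IsSubquadratic L ℓ) {v v' : E} {ρ δ : ℝ} (hρ : 1 ≤ ρ) (hv : ‖v‖ ≤ ρ) (hv' : ‖v'‖ ≤ ρ)
    (hδ : ‖v - v'‖ ≤ δ) : ℓ v - ℓ v' ≤ L * ρ * δ :=
  calc ℓ v - ℓ v' ≤ L * max 1 (max ‖v‖ ‖v'‖) * ‖v - v'‖ := (le_abs_self _).trans (h.lipschitz v v')
    _ ≤ L * ρ * δ := mul_le_mul
      (mul_le_mul_of_nonneg_left (max_le hρ (max_le hv hv')) h.const_nonneg) hδ (norm_nonneg _)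
      (mul_nonneg h.const_nonneg (zero_le_one.trans hρ))

variable {dx du dy dη m : ℕ}

/-- The lag-0 term contains an identity block, so it does not shrink a unit input; such an input
exists only if `du > 0`. -/
theorem one_le_of_l1op {G : Markov (Fin dy ⊕ Fin du) (Fin du)} {r : ℝ} (hr : 0 ≤ r)
    (h0 : G 0 = Matrix.fromRows 0 1) (hG : l1op G ≤ ENNReal.ofReal r) (hdu : 0 < du) :
    1 ≤ r := by
  have h1 : ‖G 0‖ ≤ r := by simpa using sum_norm_le_of_l1op hr hG {0}
  refine le_trans ?_ h1
  let u : Vec du := EuclideanSpace.single ⟨0, hdu⟩ 1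
  have hu : ‖u‖ = 1 := by simp [u]
  calc (1 : ℝ) = ‖u‖ := hu.symm
    _ ≤ ‖act (G 0) u‖ := by
      rw [h0, act_fromRows, act_one]
      exact norm_snd_le_norm_stack _ _
    _ ≤ ‖G 0‖ * ‖u‖ := norm_act_le _ _
    _ = ‖G 0‖ := by rw [hu, mul_one]

/-- Losses of two responses to exogenous inputs that differ by `O(1/T)`. -/
theorem loss_sub_le {E : Type*} [NormedAddCommGroup E] {L : ℝ} {ℓ : E → ℝ}
    (hℓ : IsSubquadratic L ℓ) {Rnat R₀ RM c N : ℝ} (hRnat : 1 ≤ Rnat) (hRM : 1 ≤ RM) (hc : 0 ≤ c)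
    (hN : 0 ≤ N) {v x x' : E} (hR₀ : 1 ≤ R₀ ∨ x = x') (hv : ‖v‖ ≤ Rnat)
    (hx : ‖x‖ ≤ R₀ * (RM * Rnat)) (hx' : ‖x'‖ ≤ R₀ * (RM * Rnat))
    (hxx' : ‖x - x'‖ ≤ 2 * (c * R₀ / N) * (RM * Rnat)) :
    ℓ (v + x) - ℓ (v + x') ≤ 4 * L * c * RM ^ 2 * R₀ ^ 2 * Rnat ^ 2 / N := by
  have hL := hℓ.const_nonneg
  rcases hR₀ with hR₀ | rfl
  · have hq : 1 ≤ R₀ * RM := one_le_mul_of_one_le_of_one_le hR₀ hRM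
    have hRq : Rnat ≤ R₀ * (RM * Rnat) := by nlinarith
    -- `R₀, RM ≥ 1` lets `Rnat` be absorbed into the bound on the response, whence the first factor
    -- 2; the second one comes from the bound on `x - x'`.
    refine (hℓ.sub_le (ρ := 2 * (R₀ * (RM * Rnat)))
      (δ := 2 * (c * R₀ / N) * (RM * Rnat)) (by linarith)
      ((norm_add_le _ _).trans (by linarith)) ((norm_add_le _ _).trans (by linarith))
      (by rwa [add_sub_add_left_eq_sub])).trans_eq ?_
    ring
  · rw [sub_self]
    positivity

theorem controlReg_le_memoryReg (P : Plant dx du dy)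
    {ℓ : ℕ → OutVec dy du → ℝ} {L : ℝ} (hℓ : ∀ t, IsSubquadratic L (ℓ t)) {T m h : ℕ}
    (hT : 1 ≤ T) {Rnat R₀ Rstar RM c : ℝ} {ψ₀ ψstar : ℕ → ℝ}
    (hRnat : 1 ≤ Rnat) (hRM : 1 ≤ RM) (hRstar : Rstar ≤ RM) (hc : 0 < c)
    (hψ₀ : IsDecayFunction ψ₀) (hψstar : IsDecayFunction ψstar)
    (hm : ψstar m ≤ c * Rstar / T) (hh : ψ₀ (h + 1) ≤ c * R₀ / T)
    {Gv : Markov (Fin dy ⊕ Fin du) (Fin du)} (hG0 : Gv 0 = Matrix.fromRows 0 1)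
    (hGv : l1op Gv ≤ ENNReal.ofReal R₀) (hdecay : ∀ n, decay Gv n ≤ ENNReal.ofReal (ψ₀ n))
    {vnat valg : ℕ → OutVec dy du} {η : ℕ → Vec dη} (hvnat : ∀ t, ‖vnat t‖ ≤ Rnat)
    (hη : ∀ t, ‖η t‖ ≤ Rnat) (hmem : ∃ π : LDC dy du, ∀ t, ldcOut P π t = vnat t)
    {M : ℕ → Param m du dη} (hM : ∀ t < T, M t ∈ drcSet m du dη RM)
    (hvalg : ∀ t, valg t = vnat t + response Gv (fun s => drcInput (M s) η s) t) :
    controlReg P ℓ T valg (stabClass P vnat Gv η Rstar ψstar) ≤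
      memoryReg ℓ vnat Gv η h T RM M + 12 * L * c * RM ^ 2 * R₀ ^ 2 * Rnat ^ 2 := by
  have hL : 0 ≤ L := (hℓ 0).const_nonneg
  have hTpos : (0 : ℝ) < T := by exact_mod_cast hT
  -- The radii are not assumed nonnegative; their signs follow from the decay bounds.
  have nonneg_of {ψ r : ℝ} (hψ : 0 ≤ ψ) (h : ψ ≤ c * r / T) : 0 ≤ r := by
    have h1 := (le_div_iff₀ hTpos).1 (hψ.trans h)
    rw [zero_mul] at h1
    exact nonneg_of_mul_nonneg_right h1 hc
  have hR₀ : 0 ≤ R₀ := nonneg_of (hψ₀.nonneg _) hh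
  have hRs : 0 ≤ Rstar := nonneg_of (hψstar.nonneg _) hm
  have hb : 0 ≤ RM * Rnat := by positivity
  -- If `du = 0` every input is zero and `R₀ ≥ 1` may fail, but then both responses vanish.
  have hinput : ∀ w w' : ℕ → Vec du, ∀ t,
      1 ≤ R₀ ∨ response Gv w t = truncResponse Gv (h + 1) w' t := by
    intro w w' t
    rcases Nat.eq_zero_or_pos du with rfl | hdu
    · right
      simp only [response, truncResponse, Subsingleton.elim _ (0 : Vec 0), act_zero, ite_self,
        sum_const_zero]
    · exact Or.inl (one_le_of_l1op hR₀ hG0 hGv hdu)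
  have htail : ∀ {w : ℕ → Vec du} {t : ℕ}, (∀ s ≤ t, ‖w s‖ ≤ RM * Rnat) →
      ‖response Gv w t - truncResponse Gv (h + 1) w t‖ ≤ c * R₀ / T * (RM * Rnat) :=
    fun hw => (norm_response_sub_truncResponse_le (hψ₀.nonneg _) (hdecay _) hw).trans
      (mul_le_mul_of_nonneg_right hh hb)
  have hcR : 0 ≤ c * R₀ / T * (RM * Rnat) := by positivity
  set ε : ℝ := 4 * L * c * RM ^ 2 * R₀ ^ 2 * Rnat ^ 2 / T with hε
  have hTε : T * ε = 4 * L * c * RM ^ 2 * R₀ ^ 2 * Rnat ^ 2 := mul_div_cancel₀ _ hTpos.ne'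
  have halg : ∑ t ∈ range T, ℓ t (valg t) ≤
      ∑ t ∈ range T, memLoss ℓ vnat Gv η h t (fun s => embed (M s)) + T * ε := by
    have : ∀ t ∈ range T,
        ℓ t (valg t) ≤ memLoss ℓ vnat Gv η h t (fun s => embed (M s)) + ε := by
      intro t ht
      have hw : ∀ s ≤ t, ‖drcInput (M s) η s‖ ≤ RM * Rnat := fun s hs =>
        norm_drcInput_le (hM s (hs.trans_lt (mem_range.1 ht))) hη s
      rw [hvalg, memLoss_eq, ← sub_le_iff_le_add']
      exact loss_sub_le (hℓ t) hRnat hRM hc.le hTpos.le (hinput _ _ t) (hvnat t)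
        (norm_response_le hR₀ hGv hw) (norm_truncResponse_le hR₀ hGv hw _)
        ((htail hw).trans (by linarith))
    simpa [sum_add_distrib] using sum_le_sum this
  have hbench : ∀ π ∈ stabClass P vnat Gv η Rstar ψstar,
      sInf ((fun z => ∑ t ∈ range T, unaryLoss ℓ vnat Gv η h t z) ''
        (embed '' drcSet m du dη RM)) ≤ ∑ t ∈ range T, ℓ t (ldcOut P π t) + T * ε := by
    rintro π ⟨G, hconv, hG, hGdecay⟩
    let N : Param m du dη := fun i => G i
    have hN : N ∈ drcSet m du dη RM := by
      have h1 : ∑ i : Fin m, ‖N i‖ = ∑ i ∈ range m, ‖G i‖ :=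
        Fin.sum_univ_eq_sum_range (fun i => ‖G i‖) m
      exact h1.trans_le ((sum_norm_le_of_l1op hRs hG _).trans hRstar)
    -- The real `sInf` is a lower bound only for sets bounded below; nonnegative losses ensure this.
    have hbdd : BddBelow ((fun z => ∑ t ∈ range T, unaryLoss ℓ vnat Gv η h t z) ''
        (embed '' drcSet m du dη RM)) := by
      refine ⟨0, ?_⟩
      rintro _ ⟨z, -, rfl⟩
      exact sum_nonneg fun t _ => (hℓ t).nonneg _
    refine (csInf_le hbdd ⟨embed N, ⟨N, hN, rfl⟩, rfl⟩).trans ?_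
    have : ∀ t ∈ range T,
        unaryLoss ℓ vnat Gv η h t (embed N) ≤ ℓ t (ldcOut P π t) + ε := by
      intro t _
      have hw : ∀ s ≤ t, ‖response G η s‖ ≤ RM * Rnat := fun s _ =>
        (norm_response_le hRs hG fun s _ => hη s).trans
          (mul_le_mul_of_nonneg_right hRstar (by linarith))
      have hw' : ∀ s ≤ t, ‖drcInput N η s‖ ≤ RM * Rnat := fun s _ => norm_drcInput_le hN hη s
      have hd : ∀ s ≤ t, ‖response G η s - drcInput N η s‖ ≤ c * RM / T * Rnat := fun s _ => by
        rw [drcInput_eq_truncResponse]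
        refine (norm_response_sub_truncResponse_le (hψstar.nonneg _) (hGdecay _)
          fun s _ => hη s).trans (mul_le_mul_of_nonneg_right (hm.trans ?_) (by linarith))
        gcongr
      rw [hconv t, unaryLoss, memLoss_eq _ _ _ _ _ _ (fun _ => N), ← sub_le_iff_le_add']
      refine loss_sub_le (hℓ t) hRnat hRM hc.le hTpos.le
        ((hinput (response G η) (fun s => drcInput N η s) t).imp id Eq.symm) (hvnat t)
        (norm_truncResponse_le hR₀ hGv hw' _) (norm_response_le hR₀ hGv hw) ?_
      rw [norm_sub_rev]
      -- The intermediate point cuts `Gv` but keeps all of `G`: the first gap is the tail of `Gv`,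
      -- the second the tail of `G` amplified by at most `R₀`.
      calc ‖response Gv (response G η) t - truncResponse Gv (h + 1) (fun s => drcInput N η s) t‖
          ≤ ‖response Gv (response G η) t - truncResponse Gv (h + 1) (response G η) t‖ +
            ‖truncResponse Gv (h + 1) (response G η) t -
              truncResponse Gv (h + 1) (fun s => drcInput N η s) t‖ :=
            norm_sub_le_norm_sub_add_norm_sub _ _ _
        _ ≤ c * R₀ / T * (RM * Rnat) + R₀ * (c * RM / T * Rnat) := by
            refine add_le_add (htail hw) ?_
            rw [← truncResponse_sub]
            exact norm_truncResponse_le hR₀ hGv hd _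
        _ = 2 * (c * R₀ / T) * (RM * Rnat) := by ring
    simpa [sum_add_distrib] using sum_le_sum this
  -- `sInf ∅ = 0` would break the lower bound on the benchmark. The nominal law itself is a member,
  -- with conversion operator zero.
  have hne : (stabClass P vnat Gv η Rstar ψstar).Nonempty := by
    obtain ⟨π, hπ⟩ := hmem
    refine ⟨π, 0, fun t => ?_, ?_, fun n => ?_⟩
    · simp only [hπ, response, Pi.zero_apply, act_zero_matrix, sum_const_zero, act_zero, add_zero]
    · simp [l1op]
    · simp [decay]
  have hinf : sInf ((fun z => ∑ t ∈ range T, unaryLoss ℓ vnat Gv η h t z) ''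
        (embed '' drcSet m du dη RM)) - T * ε ≤
      sInf ((fun π => ∑ t ∈ range T, ℓ t (ldcOut P π t)) ''
        stabClass P vnat Gv η Rstar ψstar) := by
    refine le_csInf (hne.image _) ?_
    rintro _ ⟨π, hπ, rfl⟩
    exact sub_le_iff_le_add.2 (hbench π hπ)
  -- The two comparisons use 8 of the 12 units; nonnegativity discards the rest.
  have hpos : 0 ≤ L * c * RM ^ 2 * R₀ ^ 2 * Rnat ^ 2 := by positivity
  rw [controlReg, memoryReg]
  linarith

end Comparison

end DRC

theorem mainTheorem7 {dx du dy : ℕ} (P : Plant dx du dy)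
    (ℓ : ℕ → OutVec dy du → ℝ) (L : ℝ) (hℓ : ∀ t, IsSubquadratic L (ℓ t))
    (T m h : ℕ) (hT : 1 ≤ T)
    (Rnat R₀ Rstar RM c : ℝ) (ψ₀ ψstar : ℕ → ℝ)
    (hRnat : 1 ≤ Rnat) (hRM : 1 ≤ RM) (hRstar : Rstar ≤ RM) (hc : 0 < c)
    (hψ₀ : IsDecayFunction ψ₀) (hψstar : IsDecayFunction ψstar)
    (hm : ψstar m ≤ c * Rstar / T) (hh : ψ₀ (h + 1) ≤ c * R₀ / T) :
    -- the algorithm around a dynamic nominal controller `π₀`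
    (∀ (dη : ℕ) (π₀ : NominalController dy du dη),
      l1op (exToOut P π₀) ≤ ENNReal.ofReal R₀ →
      l1op (exToFeature P π₀) ≤ ENNReal.ofReal R₀ →
      (∀ n, decay (exToOut P π₀) n ≤ ENNReal.ofReal (ψ₀ n)) →
      (∀ n, decay (exToFeature P π₀) n ≤ ENNReal.ofReal (ψ₀ n)) →
      (∀ t, ‖natOut P π₀ t‖ ≤ Rnat) →
      (∀ t, ‖natFeature P π₀ t‖ ≤ Rnat) →
      ∀ M : ℕ → Param m du dη, (∀ t < T, M t ∈ drcSet m du dη RM) →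
        controlReg P ℓ T (algOut P π₀ (exToFeature P π₀) M)
            (stabClass P (natOut P π₀) (exToOut P π₀) (natFeature P π₀) Rstar ψstar) ≤
          memoryReg ℓ (natOut P π₀) (exToOut P π₀) (natFeature P π₀) h T RM M
            + 12 * L * c * RM ^ 2 * R₀ ^ 2 * Rnat ^ 2) ∧
    -- the algorithm around a static feedback law `K`
    (∀ K : Matrix (Fin du) (Fin dy) ℝ,
      l1op (staticMarkov P K) ≤ ENNReal.ofReal R₀ →
      (∀ n, decay (staticMarkov P K) n ≤ ENNReal.ofReal (ψ₀ n)) →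
      (∀ t, ‖staticOut P K 0 t‖ ≤ Rnat) →
      ∀ M : ℕ → Param m du dy, (∀ t < T, M t ∈ drcSet m du dy RM) →
        controlReg P ℓ T (staticAlgOut P K (staticMarkov P K) M)
            (stabClass P (staticOut P K 0) (staticMarkov P K) (staticY P K 0) Rstar ψstar) ≤
          memoryReg ℓ (staticOut P K 0) (staticMarkov P K) (staticY P K 0) h T RM M
            + 12 * L * c * RM ^ 2 * R₀ ^ 2 * Rnat ^ 2) := by
  refine ⟨fun dη π₀ hGv _ hdv _ hv hη M hM => ?_, fun K hGv hdv hv M hM => ?_⟩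
  · refine controlReg_le_memoryReg P hℓ hT hRnat hRM hRstar hc hψ₀ hψstar hm hh rfl hGv hdv hv hη
      ⟨π₀.toLDC, ldcOut_toLDC P π₀⟩ hM fun t => ?_
    rw [algOut, nomOut_eq, funext (algInput_eq P π₀ M)]
  · refine controlReg_le_memoryReg P hℓ hT hRnat hRM hRstar hc hψ₀ hψstar hm hh rfl hGv hdv hv
      -- The features are the `y`-block of nature's output and inherit its bound.
      (fun t => (norm_fst_le_norm_stack _ _).trans (hv t))
      ⟨staticLDC K, ldcOut_staticLDC P K⟩ hM fun t => ?_
    rw [staticAlgOut, staticOut_eq, funext (staticAlgInput_eq P K M)]
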